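/- Let $d\ge 2$ and $n\ge 0$ be integers. For a vector $\ell=(l_1,\dots,l_n)$ of positive real numbers put $$E_d(\ell)=\Big\{(u_1,\dots,u_n)\in (S^{d-1})^n : \sum_{k=1}^n l_k u_k=0\Big\}\subset(\mathbb R^d)^n,$$ with the diagonal action of the orthogonal group $\mathrm O(d)$. Call $\ell$ generic if there is no subset $J\subset\{1,\dots,n\}$ with $\sum_{j\in J}l_j=\sum_{j\notin J}l_j$. Two generic vectors $\ell,\ell'$ lie in the same chamber if for every $J\subset\{1,\dots,n\}$ one has $\sum_{j\in J}l_j>\sum_{j\notin J}l_j$ if and only if $\sum_{j\in J}l'_j>\sum_{j\notin J}l'_j$. Let $\ell,\ell'$ be generic vectors of $n$ positive real numbers that lie in the same chamber. Then $E_d(\ell)$ and $E_d(\ell')$ are (possibly empty) smooth embedded submanifolds of $(\mathbb R^d)^n$ of dimension $(n-1)(d-1)-1$, and they are $\mathrm O(d)$-equivariantly diffeomorphic: there is a $C^\infty$ diffeomorphism $\Phi:E_d(\ell)\to E_d(\ell')$ with $\Phi(gu)=g\,\Phi(u)$ for all $g\in \mathrm O(d)$ and $u\in E_d(\ell)$.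 (For $n\le 2$ both spaces are empty, and the assertion about the dimension is void.) -/

import Mathlib

open scoped Manifold ContDiff

noncomputable section

/-- The space `E_d(ℓ)` of closed `n`-gons in `ℝ^d` with side lengths `ℓ`, up to translation:
tuples of unit vectors `u` with `∑ ℓ k • u k = 0`. It carries the subspace topology. -/
def polygonSpace (d : ℕ) {n : ℕ} (ℓ : Fin n → ℝ) : Set (Fin n → EuclideanSpace ℝ (Fin d)) :=
  {u | (∀ k, u k ∈ Metric.sphere (0 : EuclideanSpace ℝ (Fin d)) 1) ∧ ∑ k, ℓ k • u k = 0}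

/-- A length vector is generic if no set of indices has the same total length as its
complement. -/
def IsGenericLength {n : ℕ} (ℓ : Fin n → ℝ) : Prop :=
  ¬ ∃ J : Finset (Fin n), ∑ j ∈ J, ℓ j = ∑ j ∈ Jᶜ, ℓ j

/-- Two length vectors lie in the same chamber if they have the same long sets of indices. -/
def SameChamber {n : ℕ} (ℓ ℓ' : Fin n → ℝ) : Prop :=
  ∀ J : Finset (Fin n), ∑ j ∈ J, ℓ j > ∑ j ∈ Jᶜ, ℓ j ↔ ∑ j ∈ J, ℓ' j > ∑ j ∈ Jᶜ, ℓ' j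

/-- An orthogonal matrix acts on `ℝ^d` by a norm preserving map. -/
theorem norm_toEuclideanLin_orthogonal {d : ℕ} (g : Matrix.orthogonalGroup (Fin d) ℝ)
    (x : EuclideanSpace ℝ (Fin d)) : ‖Matrix.toEuclideanLin g.1 x‖ = ‖x‖ := by
  have h : g.1.transpose * g.1 = 1 := (Matrix.mem_orthogonalGroup_iff' (Fin d) ℝ).1 g.2
  have h2 : ‖Matrix.toEuclideanLin g.1 x‖ ^ 2 = ‖x‖ ^ 2 := by
    rw [← real_inner_self_eq_norm_sq, ← real_inner_self_eq_norm_sq]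
    simp only [EuclideanSpace.inner_eq_star_dotProduct, star_trivial, Matrix.ofLp_toLpLin,
      Matrix.toLin'_apply]
    rw [Matrix.dotProduct_mulVec, Matrix.vecMul_mulVec, h, Matrix.vecMul_one]
  exact (pow_left_inj₀ (norm_nonneg _) (norm_nonneg _) two_ne_zero).1 h2

/-- The diagonal action of the orthogonal group `O(d)` on the space of polygons. -/
instance polygonSpace.mulAction (d : ℕ) {n : ℕ} (ℓ : Fin n → ℝ) :
    MulAction (Matrix.orthogonalGroup (Fin d) ℝ) (polygonSpace d ℓ) where
  smul g u := ⟨fun k => Matrix.toEuclideanLin g.1 (u.1 k), by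
    refine ⟨fun k => ?_, ?_⟩
    · have := u.2.1 k
      rw [mem_sphere_zero_iff_norm] at this ⊢
      rw [norm_toEuclideanLin_orthogonal, this]
    · have := congrArg (Matrix.toEuclideanLin g.1) u.2.2
      simpa only [map_sum, map_smul, map_zero] using this⟩
  one_smul u := by
    apply Subtype.ext
    funext k
    change Matrix.toEuclideanLin (1 : Matrix (Fin d) (Fin d) ℝ) (u.1 k) = u.1 k
    simp
  mul_smul g h u := by
    apply Subtype.ext
    funext k
    change Matrix.toEuclideanLin (g.1 * h.1) (u.1 k) =
      Matrix.toEuclideanLin g.1 (Matrix.toEuclideanLin h.1 (u.1 k))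
    simp

/-- A charted space structure (modelled on `ℝ^m`) on a subset `S` of a normed space, compatible
with the subspace topology, is the structure of a smooth embedded submanifold if it is a smooth
manifold structure for which the inclusion is a smooth embedding. -/
structure IsEmbeddedSubmanifold (m : ℕ) {V : Type*} [NormedAddCommGroup V] [NormedSpace ℝ V]
    (S : Set V) [ChartedSpace (EuclideanSpace ℝ (Fin m)) S] : Prop where
  isManifold : IsManifold (𝓡 m) ∞ S
  isSmoothEmbedding : Manifold.IsSmoothEmbedding (𝓡 m) 𝓘(ℝ, V) ∞ (Subtype.val : S → V)

/-- The dimension of the space of polygons (the value is irrelevant when `n ≤ 2`, as then the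
space is empty for generic positive `ℓ`). -/
def polygonDim (d n : ℕ) : ℕ := (n - 1) * (d - 1) - 1

end

/-! The unit sphere of `E` is the boundary at infinity of hyperbolic space: a unit vector `u` gives
the null vector `(1, u)` of the Lorentz space `ℝ × E`, hyperbolic points are the `X` with `X.1 ^ 2 -
‖X.2‖ ^ 2 = 1` and `X.1 > 0`, and hyperbolic isometries act conformally on the sphere. Given a
polygon `u` closed for `ℓ`, take the point `X` minimising the sum of Busemann functions at the `u k`
with weights `ℓ'`. The boost carrying `X` to the origin turns the critical point equation into `∑ ℓ'
k • u' k = 0` for the moved points `u'`, so `u'` is a polygon for `ℓ'`.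

Existence (`SameChamber.exists_isConformalCenter`): since `u` closes up for `ℓ`, no sufficiently
small cap carries more than half of the weight `ℓ`. The chamber condition and genericity give
strictly less than half of the weight `ℓ'`, so the function tends to infinity and has a minimum.

Uniqueness and nondegeneracy (`IsConformalCenter.unique`,
`IsConformalCenter.eq_zero_of_linearization`): Lorentzian inequalities become equalities, and a
nontrivial solution would give a vanishing signed sum of the `ℓ' k`, against genericity.
Nondegeneracy and the implicit function theorem make `X` smooth in `u`. Uniqueness makes it
equivariant, and shows that balancing with respect to `ℓ` undoes the boost. The same argument on
signs makes `0` a regular value of the equations of the polygon space. -/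

/-! ### Slice charts of subsets -/

section SliceChart

variable {V W E : Type*} [TopologicalSpace V] [TopologicalSpace W] [Zero W] [TopologicalSpace E]
  {S : Set V}

/-- The chart of a subset `S` induced by an ambient chart in which `S` is the slice `y = 0`. -/
noncomputable def OpenPartialHomeomorph.sliceChart
    (e : OpenPartialHomeomorph V (E × W)) (p : S) (h : ∀ x ∈ e.source, x ∈ S ↔ (e x).2 = 0) :
    OpenPartialHomeomorph S E := by
  classical
  have hmem : ∀ y : E, (y, (0 : W)) ∈ e.target → e.symm (y, 0) ∈ S := fun y hy =>
    (h _ (e.map_target hy)).2 (by rw [e.right_inv hy])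
  have heq : ∀ x : S, x.1 ∈ e.source → ((e x).1, (0 : W)) = e x := fun x hx =>
    Prod.ext rfl ((h x hx).1 x.2).symm
  exact
    { toFun := fun x => (e x).1
      -- The value `p` is a default off the target; on the target the condition always holds.
      invFun := fun y => if hy : e.symm (y, 0) ∈ S then ⟨e.symm (y, 0), hy⟩ else p
      source := Subtype.val ⁻¹' e.source
      target := (fun y => (y, (0 : W))) ⁻¹' e.target
      map_source' := fun x hx => by
        rw [Set.mem_preimage, heq x hx]
        exact e.map_source hx
      map_target' := fun y hy => by
        rw [dif_pos (hmem y hy)]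
        exact e.map_target hy
      left_inv' := fun x hx => by
        have h1 : e.symm ((e x).1, 0) = x := by rw [heq x hx, e.left_inv hx]
        rw [dif_pos (by rw [h1]; exact x.2)]
        exact Subtype.ext h1
      right_inv' := fun y hy => by
        rw [dif_pos (hmem y hy)]
        change (e (e.symm (y, 0))).1 = y
        rw [e.right_inv hy]
      open_source := e.open_source.preimage continuous_subtype_val
      open_target := e.open_target.preimage (by fun_prop)
      continuousOn_toFun :=
        continuous_fst.comp_continuousOn
          (e.continuousOn.comp continuous_subtype_val.continuousOn fun _ hx => hx)
      continuousOn_invFun := by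
        refine Topology.IsInducing.subtypeVal.continuousOn_iff.2 ?_
        refine (e.continuousOn_symm.comp (f := fun y : E => (y, (0 : W))) (by fun_prop)
          fun _ hy => hy).congr fun y hy => ?_
        simp only [Function.comp_apply]
        rw [dif_pos (hmem y hy)] }

variable (e : OpenPartialHomeomorph V (E × W))
  (p : S) (h : ∀ x ∈ e.source, x ∈ S ↔ (e x).2 = 0)

theorem OpenPartialHomeomorph.sliceChart_apply (x : S) : e.sliceChart p h x = (e x).1 := rfl

theorem OpenPartialHomeomorph.sliceChart_source :
    (e.sliceChart p h).source = Subtype.val ⁻¹' e.source := rfl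

theorem OpenPartialHomeomorph.coe_sliceChart_symm_apply {y : E}
    (hy : y ∈ (e.sliceChart p h).target) :
    ((e.sliceChart p h).symm y : V) = e.symm (y, 0) := by
  have hmem : e.symm (y, 0) ∈ S := (h _ (e.map_target hy)).2 (by rw [e.right_inv hy])
  simp only [OpenPartialHomeomorph.sliceChart]
  exact congrArg Subtype.val (dif_pos hmem)

end SliceChart

/-! ### Embedded submanifolds and the regular value theorem -/

section Submanifolds

open Module

variable {V W : Type*} [NormedAddCommGroup V] [NormedSpace ℝ V] [NormedAddCommGroup W]
  [NormedSpace ℝ W]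

/-- A smooth map with surjective differential at `p` is, in suitable coordinates around `p`,
the projection onto a factor. -/
theorem exists_openPartialHomeomorph_snd_eq [FiniteDimensional ℝ V] [FiniteDimensional ℝ W]
    {m : ℕ} {F : V → W} (hF : ContDiff ℝ ∞ F) {p : V}
    (hsurj : Function.Surjective (fderiv ℝ F p)) (hdim : finrank ℝ V = m + finrank ℝ W) :
    ∃ e : OpenPartialHomeomorph V (EuclideanSpace ℝ (Fin m) × W), p ∈ e.source ∧
      ContDiffOn ℝ ∞ e e.source ∧ ContDiffOn ℝ ∞ e.symm e.target ∧ ∀ x, (e x).2 = F x := by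
  have : CompleteSpace V := FiniteDimensional.complete ℝ V
  set K := LinearMap.ker (fderiv ℝ F p : V →ₗ[ℝ] W) with hK
  have hKdim : finrank ℝ K = finrank ℝ (EuclideanSpace ℝ (Fin m)) := by
    have h1 := LinearMap.finrank_range_add_finrank_ker (fderiv ℝ F p : V →ₗ[ℝ] W)
    rw [LinearMap.range_eq_top.2 hsurj, finrank_top, ← hK] at h1
    rw [finrank_euclideanSpace_fin]
    omega
  -- A linear retraction onto the kernel supplies the coordinates that `F` does not see.
  obtain ⟨π, hπ⟩ := LinearMap.exists_leftInverse_of_injective K.subtype K.ker_subtype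
  let T : V →L[ℝ] EuclideanSpace ℝ (Fin m) :=
    LinearMap.toContinuousLinearMap ((LinearEquiv.ofFinrankEq _ _ hKdim).toLinearMap ∘ₗ π)
  let A : V →L[ℝ] EuclideanSpace ℝ (Fin m) × W := T.prod (fderiv ℝ F p)
  have hA : Function.Injective A := by
    refine (injective_iff_map_eq_zero A).2 fun v hv => ?_
    obtain ⟨h1, h2⟩ := Prod.mk.inj hv
    have h3 : π v = 0 := (LinearEquiv.ofFinrankEq _ _ hKdim).map_eq_zero_iff.1 h1
    have h4 := LinearMap.congr_fun hπ ⟨v, h2⟩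
    simp only [LinearMap.comp_apply, Submodule.subtype_apply, h3, LinearMap.id_apply] at h4
    exact (congrArg Subtype.val h4).symm
  have hdim' : finrank ℝ V = finrank ℝ (EuclideanSpace ℝ (Fin m) × W) := by
    rw [finrank_prod, finrank_euclideanSpace_fin, hdim]
  let A' : V ≃L[ℝ] EuclideanSpace ℝ (Fin m) × W :=
    (LinearMap.linearEquivOfInjective (A : V →ₗ[ℝ] EuclideanSpace ℝ (Fin m) × W) hA
      hdim').toContinuousLinearEquiv
  have hA' : (A' : V →L[ℝ] EuclideanSpace ℝ (Fin m) × W) = A := by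
    ext1 v
    rfl
  let G : V → EuclideanSpace ℝ (Fin m) × W := fun x => (T x, F x)
  have hG : ContDiff ℝ ∞ G := T.contDiff.prodMk hF
  have hGp : HasFDerivAt G (A' : V →L[ℝ] EuclideanSpace ℝ (Fin m) × W) p := by
    rw [hA']
    exact T.hasFDerivAt.prodMk ((hF.differentiable (by simp)) p).hasFDerivAt
  let e₀ := hG.contDiffAt.toOpenPartialHomeomorph G hGp (by simp)
  -- The inverse function theorem gives smoothness of the inverse at one point only. On the open set
  -- where the derivative stays invertible it holds throughout.
  let U : Set V := fderiv ℝ G ⁻¹' Set.range ((↑) :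
    (V ≃L[ℝ] EuclideanSpace ℝ (Fin m) × W) → V →L[ℝ] EuclideanSpace ℝ (Fin m) × W)
  have hU : IsOpen U := ContinuousLinearEquiv.isOpen.preimage (hG.continuous_fderiv (by simp))
  have hpU : p ∈ U := ⟨A', hGp.fderiv.symm⟩
  refine ⟨e₀.restrOpen U hU, ⟨?_, hpU⟩, hG.contDiffOn, fun y hy => ?_, fun x => rfl⟩
  · exact hG.contDiffAt.mem_toOpenPartialHomeomorph_source hGp (by simp)
  · have hy' := (e₀.restrOpen U hU).map_target hy
    obtain ⟨B, hB⟩ := hy'.2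
    refine ((e₀.restrOpen U hU).contDiffAt_symm hy (f₀' := B) ?_ ?_).contDiffWithinAt
    · rw [hB]
      exact ((hG.differentiable (by simp)) _).hasFDerivAt
    · exact hG.contDiffAt

/-- A subset that is locally a slice in smooth ambient charts is an embedded submanifold. -/
theorem exists_isEmbeddedSubmanifold_of_slices {m : ℕ} {S : Set V}
    (L : (EuclideanSpace ℝ (Fin m) × W) ≃L[ℝ] V)
    (hS : ∀ p : S, ∃ e : OpenPartialHomeomorph V (EuclideanSpace ℝ (Fin m) × W), p.1 ∈ e.source ∧
      ContDiffOn ℝ ∞ e e.source ∧ ContDiffOn ℝ ∞ e.symm e.target ∧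
      ∀ x ∈ e.source, x ∈ S ↔ (e x).2 = 0) :
    ∃ _ : ChartedSpace (EuclideanSpace ℝ (Fin m)) S, IsEmbeddedSubmanifold m S := by
  choose e hpe he hesymm heS using hS
  let c : S → OpenPartialHomeomorph S (EuclideanSpace ℝ (Fin m)) := fun p =>
    (e p).sliceChart p (heS p)
  let cs : ChartedSpace (EuclideanSpace ℝ (Fin m)) S :=
    { atlas := Set.range c
      chartAt := c
      mem_chart_source := fun p => hpe p
      chart_mem_atlas := fun p => ⟨p, rfl⟩ }
  have hman : IsManifold (𝓡 m) ∞ S := by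
    refine isManifold_of_contDiffOn (𝓡 m) ∞ S ?_
    rintro _ _ ⟨p, rfl⟩ ⟨q, rfl⟩
    simp only [modelWithCornersSelf_coe, modelWithCornersSelf_coe_symm, Function.id_comp,
      Function.comp_id, Set.preimage_id, Set.range_id, Set.inter_univ,
      OpenPartialHomeomorph.coe_trans]
    have h1 : ∀ y ∈ ((c p).symm.trans (c q)).source, (y, (0 : W)) ∈ (e p).target ∧
        (e p).symm (y, 0) ∈ (e q).source := by
      intro y hy
      rw [OpenPartialHomeomorph.trans_source] at hy
      refine ⟨hy.1, ?_⟩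
      have h2 := hy.2
      rw [Set.mem_preimage, OpenPartialHomeomorph.sliceChart_source, Set.mem_preimage,
        (e p).coe_sliceChart_symm_apply p (heS p) hy.1] at h2
      exact h2
    have h2 : ContDiffOn ℝ ∞ (fun y => (e q ((e p).symm (y, (0 : W)))).1)
        ((c p).symm.trans (c q)).source := by
      refine contDiff_fst.comp_contDiffOn ?_
      refine (he q).comp ?_ fun y hy => (h1 y hy).2
      exact (hesymm p).comp (contDiff_id.prodMk contDiff_const).contDiffOn
        fun y hy => (h1 y hy).1
    refine h2.congr fun y hy => ?_
    rw [OpenPartialHomeomorph.trans_source] at hy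
    simp only [Function.comp_apply, c, OpenPartialHomeomorph.sliceChart_apply]
    rw [(e p).coe_sliceChart_symm_apply p (heS p) hy.1]
  refine ⟨cs, hman, ?_, Topology.IsEmbedding.subtypeVal⟩
  refine Manifold.IsImmersionOfComplement.isImmersion (F := W) fun p => ?_
  -- Charts of `V` must take values in `V`, so the slice chart is followed by `L`, under which the
  -- slice is the image of the first factor.
  have hcod : (e p).trans L.toHomeomorph.toOpenPartialHomeomorph ∈
      IsManifold.maximalAtlas 𝓘(ℝ, V) ∞ V := by
    refine StructureGroupoid.mem_maximalAtlas_of_mem_groupoid _ ?_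
    rw [contDiffGroupoid, mem_groupoid_of_pregroupoid]
    constructor
    · simpa [contDiffPregroupoid] using L.contDiff.comp_contDiffOn (he p)
    · simpa [contDiffPregroupoid] using
        (hesymm p).comp L.symm.contDiff.contDiffOn fun x hx => by simpa using hx
  refine Manifold.IsImmersionAtOfComplement.mk_of_charts L (c p)
    ((e p).trans L.toHomeomorph.toOpenPartialHomeomorph) (hpe p) (by simpa using hpe p)
    (IsManifold.chart_mem_maximalAtlas p) hcod
    (fun x hx => by simpa using (show x.1 ∈ (e p).source from hx)) ?_
  intro y hy
  have hy' : y ∈ (c p).target := by simpa using hy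
  have hy'' : (y, (0 : W)) ∈ (e p).target := hy'
  simp [c, (e p).coe_sliceChart_symm_apply p (heS p) hy', (e p).right_inv hy'']

/-- The regular value theorem. -/
theorem exists_isEmbeddedSubmanifold_of_regular [FiniteDimensional ℝ V] [FiniteDimensional ℝ W]
    {m : ℕ} {F : V → W} (hF : ContDiff ℝ ∞ F)
    (hsurj : ∀ p, F p = 0 → Function.Surjective (fderiv ℝ F p))
    (hdim : finrank ℝ V = m + finrank ℝ W) :
    ∃ _ : ChartedSpace (EuclideanSpace ℝ (Fin m)) (F ⁻¹' {0}),
      IsEmbeddedSubmanifold m (F ⁻¹' {0}) := by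
  have hdim' : finrank ℝ (EuclideanSpace ℝ (Fin m) × W) = finrank ℝ V := by
    rw [finrank_prod, finrank_euclideanSpace_fin, hdim]
  refine exists_isEmbeddedSubmanifold_of_slices
    (LinearEquiv.ofFinrankEq _ _ hdim').toContinuousLinearEquiv fun p => ?_
  obtain ⟨e, h1, h2, h3, h4⟩ := exists_openPartialHomeomorph_snd_eq hF (hsurj p p.2) hdim
  exact ⟨e, h1, h2, h3, fun x _ => by rw [h4]; rfl⟩

/-- An embedded submanifold structure on the empty set. -/
theorem exists_isEmbeddedSubmanifold_of_eq_empty {m : ℕ} {S : Set V} (hS : S = ∅) :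
    ∃ _ : ChartedSpace (EuclideanSpace ℝ (Fin m)) S, IsEmbeddedSubmanifold m S := by
  have : IsEmpty S := Set.isEmpty_coe_sort.2 hS
  let cs : ChartedSpace (EuclideanSpace ℝ (Fin m)) S := ChartedSpace.empty _ _
  refine ⟨cs, inferInstance, ?_, Topology.IsEmbedding.subtypeVal⟩
  exact Manifold.IsImmersionOfComplement.isImmersion (F := V) fun p => isEmptyElim p

/-- A map between embedded submanifolds that is the restriction of a smooth map is smooth. -/
theorem IsEmbeddedSubmanifold.contMDiff_of_contDiffOn {V' : Type*} [NormedAddCommGroup V']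
    [NormedSpace ℝ V'] {m m' : ℕ} {S : Set V} {S' : Set V'}
    [ChartedSpace (EuclideanSpace ℝ (Fin m)) S] [ChartedSpace (EuclideanSpace ℝ (Fin m')) S']
    (hS : IsEmbeddedSubmanifold m S) (hS' : IsEmbeddedSubmanifold m' S') {f : V → V'}
    (hf : ContDiffOn ℝ ∞ f S) {φ : S → S'} (hφ : ∀ x, (φ x : V') = f x) :
    ContMDiff (𝓡 m) (𝓡 m') ∞ φ := by
  rw [ContMDiff.iff_comp_isImmersion hS'.isSmoothEmbedding.isImmersion]
  have h : Subtype.val ∘ φ = f ∘ Subtype.val := funext hφ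
  constructor
  · rw [Topology.IsInducing.subtypeVal.continuous_iff, h]
    exact hf.continuousOn.comp_continuous continuous_subtype_val fun x => x.2
  · rw [h]
    exact hf.contMDiffOn.comp_contMDiff hS.isSmoothEmbedding.contMDiff fun x => x.2

end Submanifolds

/-! ### Null vectors and boosts in Lorentz space -/

section LorentzGeometry

open scoped RealInnerProductSpace

variable {E : Type*} [NormedAddCommGroup E] [InnerProductSpace ℝ E]

/-- The Lorentzian product on `ℝ × E` of `X` with the vector `(1, u)`, which is null if `u` is a
unit vector. -/
def nullPairing (X : ℝ × E) (u : E) : ℝ := X.1 - ⟪X.2, u⟫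

theorem nullPairing_pos {X : ℝ × E} (hX : ‖X.2‖ < X.1) {u : E} (hu : ‖u‖ = 1) :
    0 < nullPairing X u := by
  have := real_inner_le_norm X.2 u
  rw [hu, mul_one] at this
  unfold nullPairing
  linarith

theorem nullPairing_sub (X Y : ℝ × E) (u : E) :
    nullPairing (X - Y) u = nullPairing X u - nullPairing Y u := by
  simp only [nullPairing, Prod.fst_sub, Prod.snd_sub, inner_sub_left]
  ring

theorem nullPairing_smul (c : ℝ) (X : ℝ × E) (u : E) :
    nullPairing (c • X) u = c * nullPairing X u := by
  simp only [nullPairing, Prod.smul_fst, Prod.smul_snd, real_inner_smul_left, smul_eq_mul]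
  ring

/-- A vector orthogonal to a null vector is not timelike. -/
theorem sq_fst_le_of_nullPairing_eq_zero {W : ℝ × E} {u : E} (hu : ‖u‖ = 1)
    (h : nullPairing W u = 0) : W.1 ^ 2 ≤ ‖W.2‖ ^ 2 := by
  have h1 : W.1 = ⟪W.2, u⟫ := sub_eq_zero.1 h
  have h2 := abs_real_inner_le_norm W.2 u
  rw [hu, mul_one, ← h1] at h2
  exact sq_le_sq' (by linarith [neg_abs_le W.1]) ((le_abs_self _).trans h2)

/-- A vector orthogonal to a timelike vector is spacelike or zero. -/
theorem eq_zero_of_orthogonal_timelike {X Z : ℝ × E} (hX : ‖X.2‖ < X.1)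
    (h : Z.1 * X.1 = ⟪Z.2, X.2⟫) (hZ : ‖Z.2‖ ^ 2 ≤ Z.1 ^ 2) : Z = 0 := by
  have hX1 : 0 < X.1 := (norm_nonneg _).trans_lt hX
  have h1 := abs_real_inner_le_norm Z.2 X.2
  rw [← h, abs_mul, abs_of_pos hX1] at h1
  have h2 : ‖Z.2‖ ≤ |Z.1| := abs_le_of_sq_le_sq' (by rwa [sq_abs]) (abs_nonneg _) |>.2
  have h3 : |Z.1| = 0 := by
    by_contra hne
    have hpos : 0 < |Z.1| := lt_of_le_of_ne (abs_nonneg _) (Ne.symm hne)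
    nlinarith [mul_le_mul_of_nonneg_right h2 (norm_nonneg X.2), mul_lt_mul_of_pos_left hX hpos]
  rw [h3] at h2
  exact Prod.ext (abs_eq_zero.1 h3) (norm_eq_zero.1 (le_antisymm h2 (norm_nonneg _)))

/-- For a point `X` of the hyperboloid, the conformal transformation of the unit sphere induced by
the hyperbolic translation that moves `X` to the origin. -/
noncomputable def sphereBoost (X : ℝ × E) (u : E) : E :=
  (nullPairing X u)⁻¹ • (u - (1 + X.1)⁻¹ • X.2) - (1 + X.1)⁻¹ • X.2

section Boost

variable {X : ℝ × E} {u : E}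

/-- The boost taking `X` to `(1, 0)` maps `(1, u)` to `nullPairing X u` times `(1, sphereBoost X
u)`, and the image of a null vector is null. -/
theorem norm_sphereBoost (hX : ‖X.2‖ < X.1) (hX1 : X.1 ^ 2 - ‖X.2‖ ^ 2 = 1) (hu : ‖u‖ = 1) :
    ‖sphereBoost X u‖ = 1 := by
  have hx : 0 < 1 + X.1 := by linarith [(norm_nonneg _).trans_lt hX]
  have hB := nullPairing_pos hX hu
  have hXu : ⟪X.2, u⟫ = X.1 - nullPairing X u := by unfold nullPairing; ring
  have h2 : ‖X.2‖ ^ 2 = X.1 ^ 2 - 1 := by linarith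
  have h : ‖sphereBoost X u‖ ^ 2 = 1 := by
    unfold sphereBoost
    -- With `⟪X.2, u⟫ = X.1 - B` and `‖X.2‖ ^ 2 = X.1 ^ 2 - 1` the claim is a rational identity in
    -- `X.1` and `B`.
    generalize nullPairing X u = B at *
    rw [norm_sub_sq_real, norm_smul, mul_pow, norm_sub_sq_real, real_inner_smul_left,
      real_inner_smul_right, real_inner_smul_right, inner_sub_left, real_inner_smul_left,
      real_inner_self_eq_norm_sq, real_inner_comm, hXu, norm_smul, mul_pow, h2, hu,
      Real.norm_eq_abs, Real.norm_eq_abs, sq_abs, sq_abs]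
    field_simp
    ring
  exact (pow_eq_one_iff_of_nonneg (norm_nonneg _) two_ne_zero).1 h

/-- The same boost sends `(1, 0)` to `(X.1, -X.2)` and preserves the Lorentz product, which is `1`
on `(1, 0)` and `(1, u)`. The factor scaling the null vector leaves the inverse. -/
theorem nullPairing_conj_sphereBoost (hX : ‖X.2‖ < X.1) (hX1 : X.1 ^ 2 - ‖X.2‖ ^ 2 = 1)
    (hu : ‖u‖ = 1) :
    nullPairing (X.1, -X.2) (sphereBoost X u) = (nullPairing X u)⁻¹ := by
  have hx : 0 < 1 + X.1 := by linarith [(norm_nonneg _).trans_lt hX]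
  have hB := nullPairing_pos hX hu
  have hXu : ⟪X.2, u⟫ = X.1 - nullPairing X u := by unfold nullPairing; ring
  have h2 : ‖X.2‖ ^ 2 = X.1 ^ 2 - 1 := by linarith
  rw [nullPairing, sphereBoost]
  generalize nullPairing X u = B at *
  rw [inner_neg_left, inner_sub_right, real_inner_smul_right, inner_sub_right,
    real_inner_smul_right, real_inner_self_eq_norm_sq, h2, hXu]
  field_simp
  ring

theorem sphereBoost_conj_sphereBoost (hX : ‖X.2‖ < X.1) (hX1 : X.1 ^ 2 - ‖X.2‖ ^ 2 = 1)
    (hu : ‖u‖ = 1) :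
    sphereBoost (X.1, -X.2) (sphereBoost X u) = u := by
  have hB := (nullPairing_pos hX hu).ne'
  conv_lhs => rw [sphereBoost, nullPairing_conj_sphereBoost hX hX1 hu, sphereBoost]
  simp only [smul_neg, sub_neg_eq_add, inv_inv, sub_add_cancel]
  rw [smul_smul, mul_inv_cancel₀ hB, one_smul, sub_add_cancel]

end Boost

theorem nullPairing_map (g : E →ₗᵢ[ℝ] E) (X : ℝ × E) (u : E) :
    nullPairing (X.1, g X.2) (g u) = nullPairing X u := by
  simp [nullPairing, g.inner_map_map]

theorem sphereBoost_map (g : E →ₗᵢ[ℝ] E) (X : ℝ × E) (u : E) :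
    sphereBoost (X.1, g X.2) (g u) = g (sphereBoost X u) := by
  simp [sphereBoost, nullPairing_map]

end LorentzGeometry

/-! ### Conformal barycenters: uniqueness and nondegeneracy -/

section ConformalCenter

open scoped RealInnerProductSpace

variable {E : Type*} [NormedAddCommGroup E] [InnerProductSpace ℝ E] {n : ℕ}

/-- If a signed sum of generic lengths vanishes, the common absolute value of the coefficients is
zero. -/
theorem IsGenericLength.eq_zero_of_sum_eq_zero {ℓ : Fin n → ℝ} (hgen : IsGenericLength ℓ)
    {y : Fin n → ℝ} {q : ℝ} (hy : ∀ k, y k ^ 2 = q) (hsum : ∑ k, ℓ k * y k = 0) : q = 0 := by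
  classical
  by_contra hq
  have hq0 : 0 ≤ q := by
    by_contra hneg
    refine hgen ⟨∅, ?_⟩
    rcases isEmpty_or_nonempty (Fin n) with h | ⟨⟨k⟩⟩
    · simp
    · exact absurd ((hy k).symm ▸ sq_nonneg (y k)) hneg
  set s := √q
  have hs : 0 < s := Real.sqrt_pos.2 (lt_of_le_of_ne hq0 (Ne.symm hq))
  have hs2 : s ^ 2 = q := Real.sq_sqrt hq0
  have hcase : ∀ k, y k = s ∨ y k = -s := fun k =>
    sq_eq_sq_iff_eq_or_eq_neg.1 ((hy k).trans hs2.symm)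
  let J : Finset (Fin n) := Finset.univ.filter fun k => y k = s
  refine hgen ⟨J, ?_⟩
  rw [← Finset.sum_add_sum_compl J] at hsum
  have h1 : ∑ k ∈ J, ℓ k * y k = (∑ k ∈ J, ℓ k) * s := by
    rw [Finset.sum_mul]
    refine Finset.sum_congr rfl fun k hk => ?_
    rw [(Finset.mem_filter.1 hk).2]
  have h2 : ∑ k ∈ Jᶜ, ℓ k * y k = -(∑ k ∈ Jᶜ, ℓ k) * s := by
    rw [neg_mul, Finset.sum_mul, ← Finset.sum_neg_distrib]
    refine Finset.sum_congr rfl fun k hk => ?_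
    have hk' : y k ≠ s := by simpa [J] using hk
    rw [(hcase k).resolve_left hk']
    ring
  rw [h1, h2, ← add_mul] at hsum
  linarith [(mul_eq_zero.1 hsum).resolve_right hs.ne']

/-- `X` is a conformal barycenter of the points `u k` of the unit sphere with weights `ℓ k`. -/
structure IsConformalCenter (ℓ : Fin n → ℝ) (u : Fin n → E) (X : ℝ × E) : Prop where
  norm_lt : ‖X.2‖ < X.1
  sum_smul : ∑ k, (ℓ k / nullPairing X (u k)) • ((1 : ℝ), u k) = (∑ k, ℓ k) • X

namespace IsConformalCenter

variable {ℓ : Fin n → ℝ} {u : Fin n → E} {X Y : ℝ × E}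

theorem fst_sum (h : IsConformalCenter ℓ u X) :
    ∑ k, ℓ k / nullPairing X (u k) = (∑ k, ℓ k) * X.1 := by
  simpa [Prod.fst_sum] using congrArg Prod.fst h.sum_smul

theorem snd_sum (h : IsConformalCenter ℓ u X) :
    ∑ k, (ℓ k / nullPairing X (u k)) • u k = (∑ k, ℓ k) • X.2 := by
  simpa [Prod.snd_sum] using congrArg Prod.snd h.sum_smul

/-- The balancing condition, paired with a vector. -/
theorem sum_mul_nullPairing (h : IsConformalCenter ℓ u X) (Z : ℝ × E) :
    ∑ k, ℓ k * (nullPairing Z (u k) / nullPairing X (u k)) =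
      (∑ k, ℓ k) * (Z.1 * X.1 - ⟪Z.2, X.2⟫) := by
  have h1 := congrArg (fun v => ⟪Z.2, v⟫) h.snd_sum
  simp only [inner_sum, real_inner_smul_right] at h1
  rw [mul_sub, ← h1, mul_left_comm, ← h.fst_sum, Finset.mul_sum, ← Finset.sum_sub_distrib]
  refine Finset.sum_congr rfl fun k _ => ?_
  simp only [nullPairing]
  ring

/-- Pairing the balancing condition with `X` itself makes every quotient `1`. The factor `∑ k, ℓ k`
in the definition thus already places `X` on the hyperboloid. -/
theorem sq_sub_sq (h : IsConformalCenter ℓ u X) (hu : ∀ k, ‖u k‖ = 1) (hL : ∑ k, ℓ k ≠ 0) :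
    X.1 ^ 2 - ‖X.2‖ ^ 2 = 1 := by
  have h1 := h.sum_mul_nullPairing X
  have h2 : ∀ k, nullPairing X (u k) / nullPairing X (u k) = 1 := fun k =>
    div_self (nullPairing_pos h.norm_lt (hu k)).ne'
  simp only [h2, mul_one, real_inner_self_eq_norm_sq] at h1
  have h3 := mul_left_cancel₀ hL (h1.symm.trans (mul_one _).symm)
  rw [← h3]
  ring

/-- The linearised balancing condition has only the trivial solution. -/
theorem eq_zero_of_linearization (h : IsConformalCenter ℓ u X) (hu : ∀ k, ‖u k‖ = 1)
    (hpos : ∀ k, 0 < ℓ k) (hgen : IsGenericLength ℓ) {Z : ℝ × E}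
    (hZ : ∑ k, (ℓ k * nullPairing Z (u k) / nullPairing X (u k) ^ 2) • ((1 : ℝ), u k) +
      (∑ k, ℓ k) • Z = 0) : Z = 0 := by
  -- For `n = 0` nothing is generic: both sums for `J = ∅` are zero.
  rcases isEmpty_or_nonempty (Fin n) with hn | hn
  · exact (hgen ⟨∅, by simp⟩).elim
  have hL : 0 < ∑ k, ℓ k := Finset.sum_pos (fun k _ => hpos k) Finset.univ_nonempty
  have hX1 := h.sq_sub_sq hu hL.ne'
  have hB : ∀ k, nullPairing X (u k) ≠ 0 := fun k => (nullPairing_pos h.norm_lt (hu k)).ne'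
  set b : Fin n → ℝ := fun k => nullPairing Z (u k) / nullPairing X (u k) with hb
  have hpair : ∀ Y : ℝ × E, ∑ k, ℓ k * b k * (nullPairing Y (u k) / nullPairing X (u k)) =
      -((∑ k, ℓ k) * (Y.1 * Z.1 - ⟪Y.2, Z.2⟫)) := by
    intro Y
    have h1 := congrArg Prod.fst hZ
    have h2 := congrArg (fun v => ⟪Y.2, v.2⟫) hZ
    simp only [Prod.fst_add, Prod.fst_sum, Prod.smul_fst, smul_eq_mul, mul_one,
      Prod.fst_zero] at h1
    simp only [Prod.snd_add, Prod.snd_sum, Prod.smul_snd, inner_add_right, inner_sum,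
      real_inner_smul_right, Prod.snd_zero, inner_zero_right] at h2
    have h3 : ∑ k, ℓ k * b k * (nullPairing Y (u k) / nullPairing X (u k)) =
        Y.1 * ∑ k, ℓ k * nullPairing Z (u k) / nullPairing X (u k) ^ 2 -
        ∑ k, ℓ k * nullPairing Z (u k) / nullPairing X (u k) ^ 2 * ⟪Y.2, u k⟫ := by
      rw [Finset.mul_sum, ← Finset.sum_sub_distrib]
      refine Finset.sum_congr rfl fun k _ => ?_
      have h4 : nullPairing Y (u k) = Y.1 - ⟪Y.2, u k⟫ := rfl
      simp only [hb]
      rw [h4]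
      field_simp
    rw [h3]
    linear_combination Y.1 * h1 - h2
  have hbX := hpair X
  simp only [div_self (hB _), mul_one] at hbX
  have hbX' := h.sum_mul_nullPairing Z
  -- The linearised equation paired with `X` and the balancing condition paired with `Z` evaluate
  -- this sum with opposite signs.
  have hsum : ∑ k, ℓ k * b k = 0 := by
    rw [real_inner_comm Z.2 X.2] at hbX
    linarith
  have horth : Z.1 * X.1 = ⟪Z.2, X.2⟫ := by
    rw [hsum] at hbX'
    linarith [(mul_eq_zero.1 hbX'.symm).resolve_left hL.ne']
  have hbZ := hpair Z
  set q := ‖Z.2‖ ^ 2 - Z.1 ^ 2 with hq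
  -- `Z - b k • X` is orthogonal to the null vector `(1, u k)`, hence not timelike, and `Z` is
  -- orthogonal to `X`. The weighted mean of these inequalities is an equality, so each of them is.
  have hle : ∀ k, b k ^ 2 ≤ q := by
    intro k
    have h1 : nullPairing (Z - b k • X) (u k) = 0 := by
      rw [nullPairing_sub, nullPairing_smul, hb]
      exact sub_eq_zero.2 (div_mul_cancel₀ _ (hB k)).symm
    have h2 := sq_fst_le_of_nullPairing_eq_zero (hu k) h1
    simp only [Prod.fst_sub, Prod.snd_sub, Prod.smul_fst, Prod.smul_snd, smul_eq_mul] at h2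
    rw [norm_sub_sq_real, norm_smul, mul_pow, Real.norm_eq_abs, sq_abs, real_inner_smul_right,
      ← horth] at h2
    have h3 : b k ^ 2 * (X.1 ^ 2 - ‖X.2‖ ^ 2) = b k ^ 2 := by rw [hX1, mul_one]
    nlinarith
  have hzero : ∑ k, ℓ k * (q - b k ^ 2) = 0 := by
    have h1 : ∑ k, ℓ k * b k ^ 2 = (∑ k, ℓ k) * q := by
      rw [real_inner_self_eq_norm_sq] at hbZ
      have h2 : ∀ k, ℓ k * b k ^ 2 = ℓ k * b k * (nullPairing Z (u k) / nullPairing X (u k)) :=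
        fun k => by simp only [hb]; ring
      rw [Finset.sum_congr rfl fun k _ => h2 k, hbZ, hq]
      ring
    simp only [mul_sub, Finset.sum_sub_distrib, ← Finset.sum_mul]
    rw [h1, sub_self]
  have heq : ∀ k, b k ^ 2 = q := by
    intro k
    have h1 := (Finset.sum_eq_zero_iff_of_nonneg fun k _ =>
      mul_nonneg (hpos k).le (sub_nonneg.2 (hle k))).1 hzero k (Finset.mem_univ k)
    linarith [(mul_eq_zero.1 h1).resolve_left (hpos k).ne']
  have hq0 : q = 0 := hgen.eq_zero_of_sum_eq_zero heq hsum
  exact eq_zero_of_orthogonal_timelike h.norm_lt horth (by linarith)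

/-- For the ratios `r k` of the two pairings, `Y - r k • X` is not timelike, so `r k + (r k)⁻¹ ≤ 2 *
c`. Both `r` and `r⁻¹` have weighted mean `c`, which forces equality. Then `r k - c` has constant
absolute value and weighted sum zero, so genericity gives `c = 1`, the case of hyperbolic distance
zero. -/
theorem unique (hX : IsConformalCenter ℓ u X) (hY : IsConformalCenter ℓ u Y)
    (hu : ∀ k, ‖u k‖ = 1) (hpos : ∀ k, 0 < ℓ k) (hgen : IsGenericLength ℓ) : X = Y := by
  rcases isEmpty_or_nonempty (Fin n) with hn | hn
  · exact (hgen ⟨∅, by simp⟩).elim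
  have hL : 0 < ∑ k, ℓ k := Finset.sum_pos (fun k _ => hpos k) Finset.univ_nonempty
  have hX1 := hX.sq_sub_sq hu hL.ne'
  have hY1 := hY.sq_sub_sq hu hL.ne'
  set c := Y.1 * X.1 - ⟪Y.2, X.2⟫ with hc
  set r : Fin n → ℝ := fun k => nullPairing Y (u k) / nullPairing X (u k) with hr
  have hr0 : ∀ k, 0 < r k := fun k =>
    div_pos (nullPairing_pos hY.norm_lt (hu k)) (nullPairing_pos hX.norm_lt (hu k))
  have hsum1 : ∑ k, ℓ k * r k = (∑ k, ℓ k) * c := hX.sum_mul_nullPairing Y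
  have hsum2 : ∑ k, ℓ k * (r k)⁻¹ = (∑ k, ℓ k) * c := by
    have h1 := hY.sum_mul_nullPairing X
    rw [real_inner_comm, mul_comm X.1] at h1
    rw [← h1]
    exact Finset.sum_congr rfl fun k _ => by simp only [hr, inv_div]
  have hle : ∀ k, r k ^ 2 + 1 ≤ 2 * c * r k := by
    intro k
    have h1 : nullPairing (Y - r k • X) (u k) = 0 := by
      rw [nullPairing_sub, nullPairing_smul, hr]
      exact sub_eq_zero.2 (div_mul_cancel₀ _ (nullPairing_pos hX.norm_lt (hu k)).ne').symm
    have h2 := sq_fst_le_of_nullPairing_eq_zero (hu k) h1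
    simp only [Prod.fst_sub, Prod.snd_sub, Prod.smul_fst, Prod.smul_snd, smul_eq_mul] at h2
    rw [norm_sub_sq_real, norm_smul, mul_pow, Real.norm_eq_abs, sq_abs,
      real_inner_smul_right] at h2
    have h3 : r k ^ 2 * (X.1 ^ 2 - ‖X.2‖ ^ 2) = r k ^ 2 := by rw [hX1, mul_one]
    rw [hc]
    nlinarith
  have hle' : ∀ k, 0 ≤ 2 * c - r k - (r k)⁻¹ := by
    intro k
    have h1 : 2 * c - r k - (r k)⁻¹ = (2 * c * r k - (r k ^ 2 + 1)) / r k := by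
      field_simp [(hr0 k).ne']
      ring
    rw [h1]
    exact div_nonneg (sub_nonneg.2 (hle k)) (hr0 k).le
  have hzero : ∑ k, ℓ k * (2 * c - r k - (r k)⁻¹) = 0 := by
    simp only [mul_sub, Finset.sum_sub_distrib, ← Finset.sum_mul]
    rw [hsum1, hsum2]
    ring
  have heq : ∀ k, (r k - c) ^ 2 = c ^ 2 - 1 := by
    intro k
    have h1 := (Finset.sum_eq_zero_iff_of_nonneg fun k _ =>
      mul_nonneg (hpos k).le (hle' k)).1 hzero k (Finset.mem_univ k)
    have h2 := (mul_eq_zero.1 h1).resolve_left (hpos k).ne'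
    have h3 : r k * (r k)⁻¹ = 1 := mul_inv_cancel₀ (hr0 k).ne'
    linear_combination -r k * h2 - h3
  have hc1 : c ^ 2 - 1 = 0 := by
    refine hgen.eq_zero_of_sum_eq_zero heq ?_
    simp only [mul_sub, Finset.sum_sub_distrib, ← Finset.sum_mul]
    rw [hsum1, sub_self]
  obtain ⟨k⟩ := hn
  have hrk : r k = c := by
    have h1 := heq k
    rw [hc1] at h1
    linarith [pow_eq_zero_iff two_ne_zero |>.1 h1]
  have hcone : c = 1 := by nlinarith [hr0 k]
  have hsub : Y - X = 0 := by
    refine eq_zero_of_orthogonal_timelike hX.norm_lt ?_ ?_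
    · simp only [Prod.fst_sub, Prod.snd_sub, inner_sub_left, real_inner_self_eq_norm_sq]
      linarith
    · simp only [Prod.fst_sub, Prod.snd_sub]
      rw [norm_sub_sq_real]
      nlinarith
  exact (sub_eq_zero.1 hsub).symm

theorem map (h : IsConformalCenter ℓ u X) (g : E →ₗᵢ[ℝ] E) :
    IsConformalCenter ℓ (fun k => g (u k)) (X.1, g X.2) := by
  refine ⟨by simpa using h.norm_lt, ?_⟩
  refine Prod.ext ?_ ?_
  · simpa [Prod.fst_sum, nullPairing_map] using h.fst_sum
  · simpa [Prod.snd_sum, nullPairing_map] using congrArg g h.snd_sum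

/-- Moving the conformal barycenter to the origin turns it into the Euclidean barycenter. -/
theorem sum_sphereBoost (h : IsConformalCenter ℓ u X) : ∑ k, ℓ k • sphereBoost X (u k) = 0 := by
  have hx : 1 + X.1 ≠ 0 := by linarith [(norm_nonneg _).trans_lt h.norm_lt]
  set a := (1 + X.1)⁻¹ • X.2 with ha
  have h1 : ∀ k, ℓ k • sphereBoost X (u k) = (ℓ k / nullPairing X (u k)) • u k -
      (ℓ k / nullPairing X (u k)) • a - ℓ k • a := fun k => by
    rw [sphereBoost, smul_sub, smul_smul, smul_sub, div_eq_mul_inv]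
  simp only [h1, Finset.sum_sub_distrib, ← Finset.sum_smul]
  rw [h.snd_sum, h.fst_sum, sub_sub, ← add_smul, ha, smul_smul, sub_eq_zero]
  congr 1
  field_simp
  ring

/-- The inverse translation moves the Euclidean barycenter to a conformal barycenter. -/
theorem conj_sphereBoost {ℓ' : Fin n → ℝ} (h : IsConformalCenter ℓ' u X) (hu : ∀ k, ‖u k‖ = 1)
    (hL : ∑ k, ℓ' k ≠ 0) (hsum : ∑ k, ℓ k • u k = 0) :
    IsConformalCenter ℓ (fun k => sphereBoost X (u k)) (X.1, -X.2) := by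
  have hx : 1 + X.1 ≠ 0 := by linarith [(norm_nonneg _).trans_lt h.norm_lt]
  have hX1 := h.sq_sub_sq hu hL
  refine ⟨by simpa using h.norm_lt, ?_⟩
  simp only [nullPairing_conj_sphereBoost h.norm_lt hX1 (hu _), div_inv_eq_mul]
  have hfst : ∑ k, ℓ k * nullPairing X (u k) = (∑ k, ℓ k) * X.1 := by
    have h1 := congrArg (fun v => ⟪X.2, v⟫) hsum
    simp only [inner_sum, real_inner_smul_right, inner_zero_right] at h1
    simp only [nullPairing, mul_sub, Finset.sum_sub_distrib, h1, ← Finset.sum_mul, sub_zero]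
  refine Prod.ext ?_ ?_
  · simpa [Prod.fst_sum] using hfst
  · simp only [Prod.snd_sum, Prod.smul_snd]
    set a := (1 + X.1)⁻¹ • X.2 with ha
    have h1 : ∀ k, (ℓ k * nullPairing X (u k)) • sphereBoost X (u k) = ℓ k • u k -
        ℓ k • a - (ℓ k * nullPairing X (u k)) • a := fun k => by
      have hB := (nullPairing_pos h.norm_lt (hu k)).ne'
      rw [sphereBoost, smul_sub, smul_smul, mul_assoc, mul_inv_cancel₀ hB, mul_one, smul_sub]
    simp only [h1, Finset.sum_sub_distrib, ← Finset.sum_smul]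
    rw [hsum, hfst, zero_sub, ← neg_smul, ← sub_smul, ha, smul_smul, smul_neg, ← neg_smul]
    congr 1
    field_simp
    ring

end IsConformalCenter

end ConformalCenter

/-! ### Existence of conformal barycenters -/

section Existence

open scoped RealInnerProductSpace
open Filter Topology

theorem exists_pos_forall_le_of_pos {ι : Type*} [Finite ι] (g : ι → ℝ) :
    ∃ δ > 0, ∀ i, 0 < g i → δ ≤ g i := by
  classical
  have := Fintype.ofFinite ι
  rcases (Finset.univ.filter fun i => 0 < g i).eq_empty_or_nonempty with h | h
  · refine ⟨1, one_pos, fun i hi => ?_⟩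
    have : i ∈ Finset.univ.filter fun i => 0 < g i := by simpa using hi
    simp [h] at this
  · obtain ⟨i, hi, hmin⟩ := Finset.exists_min_image _ g h
    exact ⟨g i, by simpa using hi, fun j hj => hmin j (by simpa using hj)⟩

variable {E : Type*} [NormedAddCommGroup E] [InnerProductSpace ℝ E] {n : ℕ}

theorem norm_lt_sqrt_one_add_sq {E : Type*} [NormedAddCommGroup E] (x : E) : ‖x‖ < √(1 + ‖x‖ ^ 2) :=
  Real.lt_sqrt_of_sq_lt (by linarith)

/-- The weighted sum of Busemann functions whose critical points are conformal barycenters. -/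
noncomputable def busemannSum (ℓ : Fin n → ℝ) (u : Fin n → E) (x : E) : ℝ :=
  ∑ k, ℓ k * Real.log (nullPairing (√(1 + ‖x‖ ^ 2), x) (u k))

theorem continuous_busemannSum (ℓ : Fin n → ℝ) {u : Fin n → E} (hu : ∀ k, ‖u k‖ = 1) :
    Continuous (busemannSum ℓ u) := by
  refine continuous_finsetSum _ fun k _ => continuous_const.mul (Continuous.log ?_ fun x => ?_)
  · unfold nullPairing
    fun_prop
  · exact (nullPairing_pos (norm_lt_sqrt_one_add_sq x) (hu k)).ne'

open Classical in
/-- The indices of the points `u k` in the spherical cap of size `ε` around `v`. -/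
noncomputable def capIndices (u : Fin n → E) (ε : ℝ) (v : E) : Finset (Fin n) :=
  Finset.univ.filter fun k => 1 - ε < ⟪u k, v⟫

/-- With `t = √(1 + ‖x‖ ^ 2)`, the pairing is at least `ε * t` outside the cap, and everywhere at
least `t - ‖x‖ = (t + ‖x‖)⁻¹ ≥ (2 * t)⁻¹`. -/
theorem le_busemannSum {ℓ : Fin n → ℝ} {u : Fin n → E} (hpos : ∀ k, 0 < ℓ k)
    (hu : ∀ k, ‖u k‖ = 1) {ε : ℝ} (hε : 0 < ε) (hε1 : ε ≤ 1) {x : E} (hx : x ≠ 0) :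
    ((∑ k ∈ (capIndices u ε (‖x‖⁻¹ • x))ᶜ, ℓ k) - ∑ k ∈ capIndices u ε (‖x‖⁻¹ • x), ℓ k) *
      Real.log √(1 + ‖x‖ ^ 2) - (∑ k, ℓ k) * (Real.log 2 - Real.log ε) ≤ busemannSum ℓ u x := by
  set J := capIndices u ε (‖x‖⁻¹ • x) with hJ
  set t := √(1 + ‖x‖ ^ 2) with ht
  have hxt : ‖x‖ < t := norm_lt_sqrt_one_add_sq x
  have ht0 : 0 < t := (norm_nonneg x).trans_lt hxt
  have ht2 : t ^ 2 = 1 + ‖x‖ ^ 2 := Real.sq_sqrt (by positivity)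
  have hx0 : 0 < ‖x‖ := norm_pos_iff.2 hx
  have hlogε : Real.log ε ≤ 0 := Real.log_nonpos hε.le hε1
  have hlog2 : 0 ≤ Real.log 2 := Real.log_nonneg (by norm_num)
  have h1 : ∀ k ∈ J, ℓ k * (-Real.log t - (Real.log 2 - Real.log ε)) ≤
      ℓ k * Real.log (nullPairing (t, x) (u k)) := by
    intro k _
    refine mul_le_mul_of_nonneg_left ?_ (hpos k).le
    have h2 : (2 * t)⁻¹ ≤ nullPairing (t, x) (u k) := by
      have h3 := real_inner_le_norm x (u k)
      rw [hu, mul_one] at h3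
      have h4 : (2 * t)⁻¹ ≤ t - ‖x‖ := by
        rw [inv_le_iff_one_le_mul₀ (by positivity)]
        nlinarith
      simp only [nullPairing]
      linarith
    have h5 := Real.log_le_log (by positivity) h2
    rw [Real.log_inv, Real.log_mul two_ne_zero ht0.ne'] at h5
    linarith
  have h2 : ∀ k ∈ Jᶜ, ℓ k * (Real.log t - (Real.log 2 - Real.log ε)) ≤
      ℓ k * Real.log (nullPairing (t, x) (u k)) := by
    intro k hk
    refine mul_le_mul_of_nonneg_left ?_ (hpos k).le
    have h3 : ⟪u k, ‖x‖⁻¹ • x⟫ ≤ 1 - ε := by simpa [hJ, capIndices] using hk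
    rw [real_inner_smul_right, inv_mul_le_iff₀ hx0, real_inner_comm] at h3
    have h4 : ε * t ≤ nullPairing (t, x) (u k) := by
      simp only [nullPairing]
      nlinarith
    have h5 := Real.log_le_log (by positivity) h4
    rw [Real.log_mul hε.ne' ht0.ne'] at h5
    linarith
  have h3 : busemannSum ℓ u x = ∑ k ∈ J, ℓ k * Real.log (nullPairing (t, x) (u k)) +
      ∑ k ∈ Jᶜ, ℓ k * Real.log (nullPairing (t, x) (u k)) := (Finset.sum_add_sum_compl J _).symm
  rw [h3, ← Finset.sum_add_sum_compl J ℓ]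
  refine le_trans (le_of_eq ?_) (add_le_add (Finset.sum_le_sum h1) (Finset.sum_le_sum h2))
  rw [← Finset.sum_mul, ← Finset.sum_mul]
  ring

/-- A critical point of the sum of Busemann functions yields a conformal barycenter. -/
theorem isConformalCenter_of_forall_le {ℓ : Fin n → ℝ} {u : Fin n → E} (hu : ∀ k, ‖u k‖ = 1)
    {x : E} (hmin : ∀ y, busemannSum ℓ u x ≤ busemannSum ℓ u y) :
    IsConformalCenter ℓ u (√(1 + ‖x‖ ^ 2), x) := by
  set t := √(1 + ‖x‖ ^ 2) with ht
  have hxt : ‖x‖ < t := norm_lt_sqrt_one_add_sq x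
  have ht0 : 0 < t := (norm_nonneg x).trans_lt hxt
  have ht2 : t ^ 2 = 1 + ‖x‖ ^ 2 := Real.sq_sqrt (by positivity)
  have hB : ∀ k, nullPairing (t, x) (u k) ≠ 0 := fun k => (nullPairing_pos hxt (hu k)).ne'
  have hderiv : ∀ h : E, HasDerivAt (fun s : ℝ => busemannSum ℓ u (x + s • h))
      (∑ k, ℓ k * ((⟪x, h⟫ / t - ⟪h, u k⟫) / nullPairing (t, x) (u k))) 0 := by
    intro h
    have h1 : HasDerivAt (fun s : ℝ => 1 + ‖x + s • h‖ ^ 2) (2 * ⟪x, h⟫) 0 := by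
      have h2 : HasDerivAt (fun s : ℝ => x + s • h) h 0 := by
        simpa using ((hasDerivAt_id (0 : ℝ)).smul_const h).const_add x
      simpa using h2.norm_sq.const_add 1
    have h2 : HasDerivAt (fun s : ℝ => √(1 + ‖x + s • h‖ ^ 2)) (⟪x, h⟫ / t) 0 := by
      have h3 := h1.sqrt (by positivity)
      simp only [zero_smul, add_zero] at h3
      rw [mul_div_mul_left _ _ two_ne_zero] at h3
      exact h3
    refine HasDerivAt.fun_sum fun k _ => HasDerivAt.const_mul _ ?_
    have h3 : HasDerivAt
        (fun s : ℝ => nullPairing (√(1 + ‖x + s • h‖ ^ 2), x + s • h) (u k))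
        (⟪x, h⟫ / t - ⟪h, u k⟫) 0 := by
      refine h2.sub ?_
      have h4 : ∀ s : ℝ, ⟪x + s • h, u k⟫ = ⟪x, u k⟫ + s * ⟪h, u k⟫ := fun s => by
        rw [inner_add_left, real_inner_smul_left]
      simp only [h4]
      simpa using ((hasDerivAt_id (0 : ℝ)).mul_const ⟪h, u k⟫).const_add ⟪x, u k⟫
    have h5 := h3.log (by simpa using hB k)
    simpa using h5
  have hcrit : ∀ h : E, ∑ k, ℓ k * ((⟪x, h⟫ / t - ⟪h, u k⟫) / nullPairing (t, x) (u k)) = 0 :=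
    fun h => IsLocalMin.hasDerivAt_eq_zero
      (Filter.Eventually.of_forall fun s => by simpa using hmin (x + s • h)) (hderiv h)
  set S₀ := ∑ k, ℓ k / nullPairing (t, x) (u k) with hS₀
  have hS : ∑ k, (ℓ k / nullPairing (t, x) (u k)) • u k = (S₀ / t) • x := by
    refine ext_inner_left ℝ fun h => ?_
    have h1 := hcrit h
    rw [inner_sum, real_inner_smul_right]
    simp only [real_inner_smul_right]
    have h2 : ∑ k, ℓ k * ((⟪x, h⟫ / t - ⟪h, u k⟫) / nullPairing (t, x) (u k)) =
        S₀ * (⟪x, h⟫ / t) - ∑ k, ℓ k / nullPairing (t, x) (u k) * ⟪h, u k⟫ := by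
      rw [hS₀, Finset.sum_mul, ← Finset.sum_sub_distrib]
      exact Finset.sum_congr rfl fun k _ => by ring
    rw [h2, real_inner_comm h x] at h1
    rw [← sub_eq_zero.1 h1]
    ring
  -- Criticality in `x` only gives proportionality to `(t, x)`. Pairing with `(t, x)`, of Lorentz
  -- square `1`, determines the factor.
  have hS₀L : S₀ = (∑ k, ℓ k) * t := by
    have h1 : ∑ k, ℓ k = t * S₀ - ⟪x, ∑ k, (ℓ k / nullPairing (t, x) (u k)) • u k⟫ := by
      rw [inner_sum, hS₀, Finset.mul_sum, ← Finset.sum_sub_distrib]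
      refine Finset.sum_congr rfl fun k _ => ?_
      rw [real_inner_smul_right]
      have h2 : ℓ k / nullPairing (t, x) (u k) * nullPairing (t, x) (u k) = ℓ k :=
        div_mul_cancel₀ _ (hB k)
      rw [← h2]
      simp only [nullPairing] at *
      rw [h2]
      linear_combination -h2
    rw [hS, real_inner_smul_right, real_inner_self_eq_norm_sq] at h1
    rw [h1]
    field_simp
    rw [ht2]
    ring
  refine ⟨hxt, Prod.ext ?_ ?_⟩
  · simpa [Prod.fst_sum] using hS₀L
  · simp only [Prod.snd_sum, Prod.smul_snd]
    rw [hS, hS₀L, mul_div_cancel_right₀ _ ht0.ne']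

/-- There are finitely many index sets, so the stability gap has a uniform bound `δ > 0`. The
Busemann sum then grows at least like `δ * log ‖x‖` and attains its minimum. -/
theorem exists_isConformalCenter [FiniteDimensional ℝ E] {ℓ : Fin n → ℝ} {u : Fin n → E}
    (hpos : ∀ k, 0 < ℓ k) (hu : ∀ k, ‖u k‖ = 1) {ε : ℝ} (hε : 0 < ε) (hε1 : ε ≤ 1)
    (hstable : ∀ v : E, ‖v‖ = 1 →
      ∑ k ∈ capIndices u ε v, ℓ k < ∑ k ∈ (capIndices u ε v)ᶜ, ℓ k) :
    ∃ X, IsConformalCenter ℓ u X := by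
  have := FiniteDimensional.proper ℝ E
  obtain ⟨δ, hδ, hgap⟩ := exists_pos_forall_le_of_pos
    fun J : Finset (Fin n) => ∑ k ∈ Jᶜ, ℓ k - ∑ k ∈ J, ℓ k
  have hnorm := tendsto_norm_cocompact_atTop (E := E)
  have hlim : Tendsto (busemannSum ℓ u) (cocompact E) atTop := by
    have h1 : Tendsto (fun x : E => δ * Real.log ‖x‖ + -((∑ k, ℓ k) * (Real.log 2 - Real.log ε)))
        (cocompact E) atTop :=
      tendsto_atTop_add_const_right _ _
        ((Real.tendsto_log_atTop.comp hnorm).const_mul_atTop hδ)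
    refine tendsto_atTop_mono' _ ?_ h1
    filter_upwards [hnorm.eventually_ge_atTop 1] with x hx
    have hx0 : x ≠ 0 := norm_pos_iff.1 (one_pos.trans_le hx)
    have hv : ‖‖x‖⁻¹ • x‖ = 1 := by
      rw [norm_smul, norm_inv, norm_norm, inv_mul_cancel₀ (norm_ne_zero_iff.2 hx0)]
    refine le_trans ?_ (le_busemannSum hpos hu hε hε1 hx0)
    have h2 := hgap _ (sub_pos.2 (hstable _ hv))
    have h3 : Real.log ‖x‖ ≤ Real.log √(1 + ‖x‖ ^ 2) :=
      Real.log_le_log (one_pos.trans_le hx) (norm_lt_sqrt_one_add_sq x).le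
    have h4 : 0 ≤ Real.log ‖x‖ := Real.log_nonneg hx
    nlinarith [mul_le_mul h2 h3 h4 (hδ.le.trans h2)]
  obtain ⟨x, hx⟩ := (continuous_busemannSum ℓ hu).exists_forall_le hlim
  exact ⟨_, isConformalCenter_of_forall_le hu hx⟩

/-- A closed polygon with side lengths `ℓ` is stable for all weights in the chamber of `ℓ`. -/
theorem SameChamber.exists_isConformalCenter [FiniteDimensional ℝ E] {ℓ ℓ' : Fin n → ℝ}
    (hchamber : SameChamber ℓ ℓ') (hpos : ∀ k, 0 < ℓ k) (hpos' : ∀ k, 0 < ℓ' k)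
    (hgen : IsGenericLength ℓ') {u : Fin n → E} (hu : ∀ k, ‖u k‖ = 1)
    (hsum : ∑ k, ℓ k • u k = 0) : ∃ X, IsConformalCenter ℓ' u X := by
  rcases isEmpty_or_nonempty (Fin n) with hn | hn
  · exact (hgen ⟨∅, by simp⟩).elim
  have hL : 0 < ∑ k, ℓ k := Finset.sum_pos (fun k _ => hpos k) Finset.univ_nonempty
  obtain ⟨δ, hδ, hgap⟩ := exists_pos_forall_le_of_pos
    fun J : Finset (Fin n) => ∑ k ∈ J, ℓ k - ∑ k ∈ Jᶜ, ℓ k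
  -- If the cap around `v` were long for `ℓ`, closedness paired with `v` would give `0 ≥ δ - ε * ∑
  -- k, ℓ k ≥ δ / 2`.
  set ε := min 1 (δ / (2 * ∑ k, ℓ k)) with hε
  have hε0 : 0 < ε := lt_min one_pos (by positivity)
  have hεL : ε * ∑ k, ℓ k ≤ δ / 2 := by
    have h1 : ε ≤ δ / (2 * ∑ k, ℓ k) := min_le_right _ _
    rw [le_div_iff₀ (by positivity)] at h1
    linarith
  refine _root_.exists_isConformalCenter hpos' hu hε0 (min_le_left _ _) fun v hv => ?_
  set J := capIndices u ε v with hJ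
  have hshort : ¬ ∑ k ∈ J, ℓ k > ∑ k ∈ Jᶜ, ℓ k := by
    intro hlong
    have h1 := hgap J (sub_pos.2 hlong)
    have h2 : ∑ k ∈ J, ℓ k * ⟪u k, v⟫ + ∑ k ∈ Jᶜ, ℓ k * ⟪u k, v⟫ = 0 := by
      rw [Finset.sum_add_sum_compl]
      have h3 := congrArg (fun w => ⟪w, v⟫) hsum
      simpa only [sum_inner, real_inner_smul_left, inner_zero_left] using h3
    have h3 : ∑ k ∈ J, ℓ k * (1 - ε) ≤ ∑ k ∈ J, ℓ k * ⟪u k, v⟫ := by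
      refine Finset.sum_le_sum fun k hk => mul_le_mul_of_nonneg_left ?_ (hpos k).le
      exact (Finset.mem_filter.1 hk).2.le
    have h4 : ∑ k ∈ Jᶜ, ℓ k * (-1) ≤ ∑ k ∈ Jᶜ, ℓ k * ⟪u k, v⟫ := by
      refine Finset.sum_le_sum fun k _ => mul_le_mul_of_nonneg_left ?_ (hpos k).le
      have h5 := abs_real_inner_le_norm (u k) v
      rw [hu, hv, mul_one] at h5
      exact (abs_le.1 h5).1
    rw [← Finset.sum_mul] at h3 h4
    have h5 : ∑ k ∈ J, ℓ k ≤ ∑ k, ℓ k :=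
      Finset.sum_le_univ_sum_of_nonneg fun k => (hpos k).le
    nlinarith
  have h1 := (hchamber J).not.1 hshort
  exact lt_of_le_of_ne (not_lt.1 h1) fun h => hgen ⟨J, h⟩

end Existence

/-! ### Smooth dependence of the conformal barycenter -/

section Smoothness

open scoped RealInnerProductSpace
open Filter Topology

variable {E : Type*} [NormedAddCommGroup E] [InnerProductSpace ℝ E] {n : ℕ}

open Classical in
/-- The conformal barycenter (zero if there is none). -/
noncomputable def conformalCenter (ℓ : Fin n → ℝ) (u : Fin n → E) : ℝ × E :=
  if h : ∃ X, IsConformalCenter ℓ u X then h.choose else 0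

theorem isConformalCenter_conformalCenter {ℓ : Fin n → ℝ} {u : Fin n → E}
    (h : ∃ X, IsConformalCenter ℓ u X) : IsConformalCenter ℓ u (conformalCenter ℓ u) := by
  rw [conformalCenter, dif_pos h]
  exact h.choose_spec

/-- The defect of the balancing condition. -/
noncomputable def balancingDefect (ℓ : Fin n → ℝ) (p : (Fin n → E) × (ℝ × E)) : ℝ × E :=
  ∑ k, (ℓ k / nullPairing p.2 (p.1 k)) • ((1 : ℝ), p.1 k) - (∑ k, ℓ k) • p.2

theorem contDiffAt_balancingDefect (ℓ : Fin n → ℝ) {p : (Fin n → E) × (ℝ × E)}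
    (hp : ∀ k, nullPairing p.2 (p.1 k) ≠ 0) : ContDiffAt ℝ ∞ (balancingDefect ℓ) p := by
  have hk : ∀ k, ContDiffAt ℝ ∞ (fun p : (Fin n → E) × (ℝ × E) => p.1 k) p := fun k =>
    (contDiff_apply ℝ E k).contDiffAt.comp p contDiffAt_fst
  refine ContDiffAt.sub (ContDiffAt.sum fun k _ => ContDiffAt.fun_smul ?_ ?_)
    (contDiffAt_snd.const_smul _)
  · refine contDiffAt_const.div ?_ (hp k)
    exact (contDiffAt_fst.comp p contDiffAt_snd).sub
      ((contDiffAt_snd.comp p contDiffAt_snd).inner ℝ (hk k))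
  · exact contDiffAt_const.prodMk (hk k)

theorem fderiv_balancingDefect_inr (ℓ : Fin n → ℝ) {u : Fin n → E} {X : ℝ × E}
    (hp : ∀ k, nullPairing X (u k) ≠ 0) (Z : ℝ × E) :
    fderiv ℝ (balancingDefect ℓ) (u, X) (0, Z) =
      -(∑ k, (ℓ k * nullPairing Z (u k) / nullPairing X (u k) ^ 2) • ((1 : ℝ), u k) +
        (∑ k, ℓ k) • Z) := by
  have h1 : HasDerivAt (fun s : ℝ => X + s • Z) Z 0 := by
    simpa using ((hasDerivAt_id (0 : ℝ)).smul_const Z).const_add X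
  have h2 : HasDerivAt (fun s : ℝ => balancingDefect ℓ (u, X + s • Z))
      (fderiv ℝ (balancingDefect ℓ) (u, X) (0, Z)) 0 := by
    have h3 : HasFDerivAt (balancingDefect ℓ) (fderiv ℝ (balancingDefect ℓ) (u, X))
        (u, X + (0 : ℝ) • Z) := by
      rw [zero_smul, add_zero]
      exact ((contDiffAt_balancingDefect ℓ hp).differentiableAt (by simp)).hasFDerivAt
    exact h3.comp_hasDerivAt (0 : ℝ) ((hasDerivAt_const (0 : ℝ) u).prodMk h1)
  have h4 : ∀ k, HasDerivAt (fun s : ℝ => nullPairing (X + s • Z) (u k))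
      (nullPairing Z (u k)) 0 := by
    intro k
    have h5 : ∀ s : ℝ, nullPairing (X + s • Z) (u k) =
        nullPairing X (u k) + s * nullPairing Z (u k) := fun s => by
      have h6 := nullPairing_sub X (-(s • Z)) (u k)
      rw [sub_neg_eq_add, ← neg_smul, nullPairing_smul] at h6
      rw [h6]
      ring
    simp only [h5]
    simpa using ((hasDerivAt_id (0 : ℝ)).mul_const (nullPairing Z (u k))).const_add
      (nullPairing X (u k))
  have h5 : HasDerivAt (fun s : ℝ => balancingDefect ℓ (u, X + s • Z))
      (∑ k, (-(ℓ k * nullPairing Z (u k)) / nullPairing X (u k) ^ 2) • ((1 : ℝ), u k) -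
        (∑ k, ℓ k) • Z) 0 := by
    have h6 : ∀ k, HasDerivAt (fun s : ℝ => ℓ k / nullPairing (X + s • Z) (u k))
        (-(ℓ k * nullPairing Z (u k)) / nullPairing X (u k) ^ 2) 0 := fun k => by
      simpa using (hasDerivAt_const (0 : ℝ) (ℓ k)).fun_div (h4 k) (by simpa using hp k)
    exact HasDerivAt.sub (HasDerivAt.fun_sum fun k _ => (h6 k).smul_const ((1 : ℝ), u k))
      (h1.fun_const_smul _)
  rw [h2.unique h5, neg_add, ← Finset.sum_neg_distrib, ← sub_eq_add_neg]
  simp only [neg_div, neg_smul]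

/-- The derivative of the defect in `X` is injective by
`IsConformalCenter.eq_zero_of_linearization`, so the implicit function theorem gives a local smooth
solution. Uniqueness identifies it with the chosen center on the given set. -/
theorem contDiffOn_conformalCenter [FiniteDimensional ℝ E] {ℓ : Fin n → ℝ}
    (hpos : ∀ k, 0 < ℓ k) (hgen : IsGenericLength ℓ) :
    ContDiffOn ℝ ∞ (conformalCenter ℓ)
      {u : Fin n → E | (∀ k, ‖u k‖ = 1) ∧ ∃ X, IsConformalCenter ℓ u X} := by
  rintro u ⟨hu, hX⟩
  have := FiniteDimensional.complete ℝ E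
  have hc := isConformalCenter_conformalCenter hX
  set X := conformalCenter ℓ u with hXdef
  have hB : ∀ k, nullPairing X (u k) ≠ 0 := fun k => (nullPairing_pos hc.norm_lt (hu k)).ne'
  have hsmooth := contDiffAt_balancingDefect (p := (u, X)) ℓ hB
  have hinv : (fderiv ℝ (balancingDefect ℓ) (u, X) ∘L
      .inr ℝ (Fin n → E) (ℝ × E)).IsInvertible := by
    set A := fderiv ℝ (balancingDefect ℓ) (u, X) ∘L .inr ℝ (Fin n → E) (ℝ × E) with hA
    have hinj : Function.Injective (A : ℝ × E →ₗ[ℝ] ℝ × E) := by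
      refine (injective_iff_map_eq_zero _).2 fun Z hZ => ?_
      refine hc.eq_zero_of_linearization hu hpos hgen ?_
      have h1 : fderiv ℝ (balancingDefect ℓ) (u, X) (0, Z) = 0 := hZ
      rw [fderiv_balancingDefect_inr ℓ hB] at h1
      exact neg_eq_zero.1 h1
    exact ⟨(LinearEquiv.ofInjectiveEndo _ hinj).toContinuousLinearEquiv,
      ContinuousLinearMap.ext fun Z => rfl⟩
  have hn : (∞ : WithTop ℕ∞) ≠ 0 := by simp
  set ψ := hsmooth.implicitFunction hn hinv with hψ
  have hψsmooth : ContDiffAt ℝ ∞ ψ u := hsmooth.contDiffAt_implicitFunction hn hinv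
  have hψu : ψ u = X := hsmooth.implicitFunction_apply_self hn hinv
  have hzero : balancingDefect ℓ (u, X) = 0 := sub_eq_zero.2 hc.sum_smul
  have hev := hsmooth.eventually_apply_implicitFunction hn hinv
  -- The timelike cone is open, so nearby solutions of the equation are genuine centers.
  have hcone : ∀ᶠ w in 𝓝 u, ‖(ψ w).2‖ < (ψ w).1 := by
    have h1 : ContinuousAt ψ u := hψsmooth.continuousAt
    exact h1.snd.norm.eventually_lt h1.fst (by rw [hψu]; exact hc.norm_lt)
  have hcenter : ∀ᶠ w in 𝓝 u, IsConformalCenter ℓ w (ψ w) := by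
    filter_upwards [hev, hcone] with w h1 h2
    rw [hzero] at h1
    exact ⟨h2, sub_eq_zero.1 h1⟩
  refine hψsmooth.contDiffWithinAt.congr_of_eventuallyEq ?_ hψu.symm
  filter_upwards [eventually_nhdsWithin_of_eventually_nhds hcenter, self_mem_nhdsWithin]
    with w h1 h2
  exact (isConformalCenter_conformalCenter h2.2).unique h1 h2.1 hpos hgen

theorem contDiffOn_sphereBoost_conformalCenter [FiniteDimensional ℝ E] {ℓ : Fin n → ℝ}
    (hpos : ∀ k, 0 < ℓ k) (hgen : IsGenericLength ℓ) :
    ContDiffOn ℝ ∞ (fun u : Fin n → E => fun k => sphereBoost (conformalCenter ℓ u) (u k))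
      {u : Fin n → E | (∀ k, ‖u k‖ = 1) ∧ ∃ X, IsConformalCenter ℓ u X} := by
  have hX := contDiffOn_conformalCenter (E := E) hpos hgen
  have hk : ∀ k, ContDiffOn ℝ ∞ (fun u : Fin n → E => u k)
      {u : Fin n → E | (∀ k, ‖u k‖ = 1) ∧ ∃ X, IsConformalCenter ℓ u X} :=
    fun k => (contDiff_apply ℝ E k).contDiffOn
  have ha : ContDiffOn ℝ ∞ (fun u : Fin n → E =>
      (1 + (conformalCenter ℓ u).1)⁻¹ • (conformalCenter ℓ u).2)
      {u : Fin n → E | (∀ k, ‖u k‖ = 1) ∧ ∃ X, IsConformalCenter ℓ u X} := by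
    refine ContDiffOn.smul (ContDiffOn.inv (contDiffOn_const.add hX.fst) fun u hu => ?_) hX.snd
    have h1 := (isConformalCenter_conformalCenter hu.2).norm_lt
    linarith [(norm_nonneg _).trans_lt h1]
  refine contDiffOn_pi.2 fun k => ?_
  refine ContDiffOn.sub (ContDiffOn.smul (ContDiffOn.inv ?_ fun u hu => ?_) ((hk k).sub ha)) ha
  · exact hX.fst.sub (hX.snd.inner ℝ (hk k))
  · exact (nullPairing_pos (isConformalCenter_conformalCenter hu.2).norm_lt (hu.1 k)).ne'

end Smoothness

/-! ### Polygon spaces and the equivariant diffeomorphism -/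

section PolygonSpace

open scoped RealInnerProductSpace
open Module

variable {E : Type*} [NormedAddCommGroup E] [InnerProductSpace ℝ E] {n : ℕ}

/-- The map whose zero set is the space of polygons. -/
def polygonMap (ℓ : Fin n → ℝ) (u : Fin n → E) : (Fin n → ℝ) × E :=
  (fun k => ‖u k‖ ^ 2 - 1, ∑ k, ℓ k • u k)

theorem polygonMap_eq_zero_iff {ℓ : Fin n → ℝ} {u : Fin n → E} :
    polygonMap ℓ u = 0 ↔ (∀ k, ‖u k‖ = 1) ∧ ∑ k, ℓ k • u k = 0 := by
  rw [polygonMap, Prod.mk_eq_zero, funext_iff]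
  refine and_congr_left fun _ => forall_congr' fun k => ?_
  rw [Pi.zero_apply, sub_eq_zero, pow_eq_one_iff_of_nonneg (norm_nonneg _) two_ne_zero]

theorem contDiff_polygonMap (ℓ : Fin n → ℝ) : ContDiff ℝ ∞ (polygonMap (E := E) ℓ) := by
  refine ContDiff.prodMk (contDiff_pi.2 fun k => ?_) (ContDiff.sum fun k _ => ?_)
  · exact ((contDiff_apply ℝ E k).norm_sq ℝ).sub contDiff_const
  · exact (contDiff_apply ℝ E k).const_smul (ℓ k)

theorem fderiv_polygonMap (ℓ : Fin n → ℝ) (u v : Fin n → E) :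
    fderiv ℝ (polygonMap ℓ) u v = (fun k => 2 * ⟪u k, v k⟫, ∑ k, ℓ k • v k) := by
  have h1 : HasDerivAt (fun s : ℝ => u + s • v) v 0 := by
    simpa using ((hasDerivAt_id (0 : ℝ)).smul_const v).const_add u
  have h2 : HasDerivAt (fun s : ℝ => polygonMap ℓ (u + s • v))
      (fderiv ℝ (polygonMap ℓ) u v) 0 := by
    have h3 : HasFDerivAt (polygonMap ℓ) (fderiv ℝ (polygonMap ℓ) u) (u + (0 : ℝ) • v) := by
      rw [zero_smul, add_zero]
      exact ((contDiff_polygonMap ℓ).differentiable (by simp) u).hasFDerivAt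
    exact h3.comp_hasDerivAt (0 : ℝ) h1
  have h4 : ∀ k, HasDerivAt (fun s : ℝ => (u + s • v) k) (v k) 0 := hasDerivAt_pi.1 h1
  refine h2.unique (HasDerivAt.prodMk (hasDerivAt_pi.2 fun k => ?_)
    (HasDerivAt.fun_sum fun k _ => (h4 k).fun_const_smul _))
  simpa using (h4 k).norm_sq.sub_const 1

/-- Radial components of the `v k` adjust the norms. Tangential ones, projections of a single vector
`z`, adjust the sum through `A`, a weighted sum of projections. A kernel vector of `A` is parallel
to every `u k`, and genericity excludes this unless it is zero. -/
theorem surjective_fderiv_polygonMap [FiniteDimensional ℝ E] {ℓ : Fin n → ℝ}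
    (hpos : ∀ k, 0 < ℓ k) (hgen : IsGenericLength ℓ) {u : Fin n → E}
    (hu : polygonMap ℓ u = 0) : Function.Surjective (fderiv ℝ (polygonMap ℓ) u) := by
  obtain ⟨hu1, hsum⟩ := polygonMap_eq_zero_iff.1 hu
  let A : E →ₗ[ℝ] E := ∑ k, ℓ k • (LinearMap.id - (innerₛₗ ℝ (u k)).smulRight (u k))
  have hA : ∀ z, A z = ∑ k, ℓ k • (z - ⟪u k, z⟫ • u k) := fun z => by
    simp [A, LinearMap.sum_apply]
  have hinj : Function.Injective A := by
    refine (injective_iff_map_eq_zero A).2 fun z hz => ?_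
    have h1 : ∑ k, ℓ k * (‖z‖ ^ 2 - ⟪u k, z⟫ ^ 2) = 0 := by
      have h2 := congrArg (fun w => ⟪z, w⟫) ((hA z).symm.trans hz)
      simp only [inner_sum, real_inner_smul_right, inner_sub_right, real_inner_self_eq_norm_sq,
        inner_zero_right] at h2
      rw [← h2]
      refine Finset.sum_congr rfl fun k _ => ?_
      rw [real_inner_comm z (u k)]
      ring
    have hle : ∀ k, ⟪u k, z⟫ ^ 2 ≤ ‖z‖ ^ 2 := fun k => by
      have h2 := abs_real_inner_le_norm (u k) z
      rw [hu1, one_mul] at h2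
      exact sq_le_sq.2 (by rwa [abs_norm])
    have heq : ∀ k, ⟪u k, z⟫ ^ 2 = ‖z‖ ^ 2 := by
      intro k
      have h2 := (Finset.sum_eq_zero_iff_of_nonneg fun k _ =>
        mul_nonneg (hpos k).le (sub_nonneg.2 (hle k))).1 h1 k (Finset.mem_univ k)
      linarith [(mul_eq_zero.1 h2).resolve_left (hpos k).ne']
    have hz0 : ‖z‖ ^ 2 = 0 := by
      refine hgen.eq_zero_of_sum_eq_zero heq ?_
      have h2 := congrArg (fun w => ⟪w, z⟫) hsum
      simpa only [sum_inner, real_inner_smul_left, inner_zero_left] using h2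
    simpa using hz0
  rintro ⟨a, w⟩
  obtain ⟨z, hz⟩ := LinearMap.injective_iff_surjective.1 hinj (w - ∑ k, ℓ k • (a k / 2) • u k)
  refine ⟨fun k => (a k / 2) • u k + (z - ⟪u k, z⟫ • u k), ?_⟩
  rw [fderiv_polygonMap]
  refine Prod.ext (funext fun k => ?_) ?_
  · simp only [inner_add_right, inner_sub_right, real_inner_smul_right,
      real_inner_self_eq_norm_sq, hu1]
    ring
  · simp only [smul_add _ (_ • _ : E), Finset.sum_add_distrib]
    rw [← hA, hz, add_sub_cancel]

theorem polygonSpace_eq_preimage (d : ℕ) (ℓ : Fin n → ℝ) :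
    polygonSpace d ℓ = polygonMap ℓ ⁻¹' {0} := by
  ext u
  rw [Set.mem_preimage, Set.mem_singleton_iff, polygonMap_eq_zero_iff]
  simp [polygonSpace]

theorem mem_polygonSpace_iff {d : ℕ} {ℓ : Fin n → ℝ} {u : Fin n → EuclideanSpace ℝ (Fin d)} :
    u ∈ polygonSpace d ℓ ↔ (∀ k, ‖u k‖ = 1) ∧ ∑ k, ℓ k • u k = 0 := by
  simp [polygonSpace]

theorem exists_isEmbeddedSubmanifold_polygonSpace {d : ℕ} (hd : 2 ≤ d) {ℓ : Fin n → ℝ}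
    (hpos : ∀ k, 0 < ℓ k) (hgen : IsGenericLength ℓ) :
    ∃ _ : ChartedSpace (EuclideanSpace ℝ (Fin (polygonDim d n))) (polygonSpace d ℓ),
      IsEmbeddedSubmanifold (polygonDim d n) (polygonSpace d ℓ) := by
  rcases (polygonSpace d ℓ).eq_empty_or_nonempty with h | ⟨p, hp⟩
  · exact exists_isEmbeddedSubmanifold_of_eq_empty h
  rw [polygonSpace_eq_preimage] at hp ⊢
  refine exists_isEmbeddedSubmanifold_of_regular (contDiff_polygonMap ℓ)
    (fun q hq => surjective_fderiv_polygonMap hpos hgen hq) ?_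
  have hV : finrank ℝ (Fin n → EuclideanSpace ℝ (Fin d)) = n * d := by
    simp [finrank_pi_fintype]
  have hW : finrank ℝ ((Fin n → ℝ) × EuclideanSpace ℝ (Fin d)) = n + d := by simp
  -- Surjectivity at an actual polygon gives this bound, which makes the truncated subtraction in
  -- `polygonDim` exact.
  have hle : n + d ≤ n * d := by
    rw [← hV, ← hW]
    exact LinearMap.finrank_le_finrank_of_surjective
      (f := (fderiv ℝ (polygonMap ℓ) p : _ →ₗ[ℝ] (Fin n → ℝ) × EuclideanSpace ℝ (Fin d)))
      (surjective_fderiv_polygonMap hpos hgen hp)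
  rw [hV, hW, polygonDim]
  obtain ⟨b, rfl⟩ : ∃ b, d = b + 1 := ⟨d - 1, by omega⟩
  obtain ⟨a, rfl⟩ : ∃ a, n = a + 1 := by
    rcases n with _ | a
    · omega
    · exact ⟨a, rfl⟩
  have h1 : (a + 1) * (b + 1) = a * b + a + b + 1 := by ring
  simp only [Nat.add_sub_cancel]
  omega

/-- The polygon `u` moved so that its conformal barycenter with weights `ℓ` becomes the origin. -/
noncomputable def balancedPolygon (ℓ : Fin n → ℝ) (u : Fin n → E) (k : Fin n) : E :=
  sphereBoost (conformalCenter ℓ u) (u k)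

section Balanced

variable {ℓ ℓ' : Fin n → ℝ}

theorem sum_ne_zero_of_isGenericLength (hpos : ∀ k, 0 < ℓ k) (hgen : IsGenericLength ℓ) :
    ∑ k, ℓ k ≠ 0 := by
  rcases isEmpty_or_nonempty (Fin n) with hn | hn
  · exact (hgen ⟨∅, by simp⟩).elim
  · exact (Finset.sum_pos (fun k _ => hpos k) Finset.univ_nonempty).ne'

theorem norm_balancedPolygon (hpos : ∀ k, 0 < ℓ k) (hgen : IsGenericLength ℓ) {u : Fin n → E}
    (hu : ∀ k, ‖u k‖ = 1) (hX : ∃ X, IsConformalCenter ℓ u X) (k : Fin n) :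
    ‖balancedPolygon ℓ u k‖ = 1 :=
  have h := isConformalCenter_conformalCenter hX
  norm_sphereBoost h.norm_lt (h.sq_sub_sq hu (sum_ne_zero_of_isGenericLength hpos hgen)) (hu k)

/-- Balancing with respect to `ℓ` inverts balancing with respect to `ℓ'` on polygons with side
lengths `ℓ`. -/
theorem balancedPolygon_balancedPolygon (hpos : ∀ k, 0 < ℓ k) (hpos' : ∀ k, 0 < ℓ' k)
    (hgen : IsGenericLength ℓ) (hgen' : IsGenericLength ℓ') {u : Fin n → E}
    (hu : ∀ k, ‖u k‖ = 1) (hsum : ∑ k, ℓ k • u k = 0) (hX : ∃ X, IsConformalCenter ℓ' u X) :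
    balancedPolygon ℓ (balancedPolygon ℓ' u) = u := by
  have h := isConformalCenter_conformalCenter hX
  have hL := sum_ne_zero_of_isGenericLength hpos' hgen'
  -- The opposite point `(X.1, -X.2)` is an `ℓ`-center of the moved polygon, so by uniqueness the
  -- second boost is inverse to the first.
  have h1 : IsConformalCenter ℓ (balancedPolygon ℓ' u) _ := h.conj_sphereBoost hu hL hsum
  have h2 := (isConformalCenter_conformalCenter ⟨_, h1⟩).unique h1
    (norm_balancedPolygon hpos' hgen' hu hX) hpos hgen
  funext k
  rw [balancedPolygon, h2]
  exact sphereBoost_conj_sphereBoost h.norm_lt (h.sq_sub_sq hu hL) (hu k)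

/-- The center is chosen arbitrarily; uniqueness makes the choice commute with isometries. -/
theorem balancedPolygon_map (hpos : ∀ k, 0 < ℓ k) (hgen : IsGenericLength ℓ) {u : Fin n → E}
    (hu : ∀ k, ‖u k‖ = 1) (hX : ∃ X, IsConformalCenter ℓ u X) (g : E →ₗᵢ[ℝ] E) (k : Fin n) :
    balancedPolygon ℓ (fun k => g (u k)) k = g (balancedPolygon ℓ u k) := by
  have h1 := (isConformalCenter_conformalCenter hX).map g
  have h2 := (isConformalCenter_conformalCenter ⟨_, h1⟩).unique h1
    (fun k => by rw [g.norm_map, hu]) hpos hgen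
  rw [balancedPolygon, h2, sphereBoost_map, balancedPolygon]

end Balanced

section Chamber

variable {d : ℕ} {ℓ ℓ' : Fin n → ℝ}

theorem SameChamber.exists_center_of_mem_polygonSpace (hchamber : SameChamber ℓ ℓ')
    (hpos : ∀ k, 0 < ℓ k) (hpos' : ∀ k, 0 < ℓ' k) (hgen' : IsGenericLength ℓ')
    {u : Fin n → EuclideanSpace ℝ (Fin d)} (hu : u ∈ polygonSpace d ℓ) :
    ∃ X, IsConformalCenter ℓ' u X :=
  hchamber.exists_isConformalCenter hpos hpos' hgen' (mem_polygonSpace_iff.1 hu).1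
    (mem_polygonSpace_iff.1 hu).2

theorem SameChamber.balancedPolygon_mem_polygonSpace (hchamber : SameChamber ℓ ℓ')
    (hpos : ∀ k, 0 < ℓ k) (hpos' : ∀ k, 0 < ℓ' k) (hgen' : IsGenericLength ℓ')
    {u : Fin n → EuclideanSpace ℝ (Fin d)} (hu : u ∈ polygonSpace d ℓ) :
    balancedPolygon ℓ' u ∈ polygonSpace d ℓ' := by
  have hX := hchamber.exists_center_of_mem_polygonSpace hpos hpos' hgen' hu
  exact mem_polygonSpace_iff.2
    ⟨norm_balancedPolygon hpos' hgen' (mem_polygonSpace_iff.1 hu).1 hX,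
      (isConformalCenter_conformalCenter hX).sum_sphereBoost⟩

theorem SameChamber.contDiffOn_balancedPolygon (hchamber : SameChamber ℓ ℓ')
    (hpos : ∀ k, 0 < ℓ k) (hpos' : ∀ k, 0 < ℓ' k) (hgen' : IsGenericLength ℓ') :
    ContDiffOn ℝ ∞ (balancedPolygon ℓ') (polygonSpace d ℓ) :=
  (contDiffOn_sphereBoost_conformalCenter hpos' hgen').mono fun _ hu =>
    ⟨(mem_polygonSpace_iff.1 hu).1,
      hchamber.exists_center_of_mem_polygonSpace hpos hpos' hgen' hu⟩

/-- The bijection between polygon spaces in the same chamber given by balancing. -/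
noncomputable def SameChamber.polygonEquiv (d : ℕ) (hchamber : SameChamber ℓ ℓ')
    (hpos : ∀ k, 0 < ℓ k) (hpos' : ∀ k, 0 < ℓ' k) (hgen : IsGenericLength ℓ)
    (hgen' : IsGenericLength ℓ') : polygonSpace d ℓ ≃ polygonSpace d ℓ' where
  toFun u := ⟨balancedPolygon ℓ' u.1,
    hchamber.balancedPolygon_mem_polygonSpace hpos hpos' hgen' u.2⟩
  invFun u := ⟨balancedPolygon ℓ u.1, SameChamber.balancedPolygon_mem_polygonSpace
    (fun J => (hchamber J).symm) hpos' hpos hgen u.2⟩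
  left_inv u := Subtype.ext <| balancedPolygon_balancedPolygon hpos hpos' hgen hgen'
    (mem_polygonSpace_iff.1 u.2).1 (mem_polygonSpace_iff.1 u.2).2
    (hchamber.exists_center_of_mem_polygonSpace hpos hpos' hgen' u.2)
  right_inv u := Subtype.ext <| balancedPolygon_balancedPolygon hpos' hpos hgen' hgen
    (mem_polygonSpace_iff.1 u.2).1 (mem_polygonSpace_iff.1 u.2).2
    (SameChamber.exists_center_of_mem_polygonSpace (fun J => (hchamber J).symm) hpos' hpos hgen
      u.2)

theorem SameChamber.polygonEquiv_smul (hchamber : SameChamber ℓ ℓ')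
    (hpos : ∀ k, 0 < ℓ k) (hpos' : ∀ k, 0 < ℓ' k) (hgen : IsGenericLength ℓ)
    (hgen' : IsGenericLength ℓ') (g : Matrix.orthogonalGroup (Fin d) ℝ)
    (u : polygonSpace d ℓ) : hchamber.polygonEquiv d hpos hpos' hgen hgen' (g • u) =
      g • hchamber.polygonEquiv d hpos hpos' hgen hgen' u :=
  Subtype.ext <| funext fun k => balancedPolygon_map hpos' hgen' (mem_polygonSpace_iff.1 u.2).1
    (hchamber.exists_center_of_mem_polygonSpace hpos hpos' hgen' u.2)
    ⟨Matrix.toEuclideanLin g.1, norm_toEuclideanLin_orthogonal g⟩ k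

end Chamber

end PolygonSpace

theorem mainTheorem9 (d n : ℕ) (hd : 2 ≤ d) (ℓ ℓ' : Fin n → ℝ)
    (hpos : ∀ k, 0 < ℓ k) (hpos' : ∀ k, 0 < ℓ' k)
    (hgen : IsGenericLength ℓ) (hgen' : IsGenericLength ℓ')
    (hchamber : SameChamber ℓ ℓ') :
    (∃ _ : ChartedSpace (EuclideanSpace ℝ (Fin (polygonDim d n))) (polygonSpace d ℓ),
      IsEmbeddedSubmanifold (polygonDim d n) (polygonSpace d ℓ)) ∧
    (∃ _ : ChartedSpace (EuclideanSpace ℝ (Fin (polygonDim d n))) (polygonSpace d ℓ'),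
      IsEmbeddedSubmanifold (polygonDim d n) (polygonSpace d ℓ')) ∧
    ∀ [ChartedSpace (EuclideanSpace ℝ (Fin (polygonDim d n))) (polygonSpace d ℓ)]
      [ChartedSpace (EuclideanSpace ℝ (Fin (polygonDim d n))) (polygonSpace d ℓ')],
      IsEmbeddedSubmanifold (polygonDim d n) (polygonSpace d ℓ) →
      IsEmbeddedSubmanifold (polygonDim d n) (polygonSpace d ℓ') →
      ∃ Φ : polygonSpace d ℓ ≃ₘ^∞⟮𝓡 (polygonDim d n), 𝓡 (polygonDim d n)⟯ polygonSpace d ℓ',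
        ∀ (g : Matrix.orthogonalGroup (Fin d) ℝ) (u : polygonSpace d ℓ),
          Φ (g • u) = g • Φ u := by
  refine ⟨exists_isEmbeddedSubmanifold_polygonSpace hd hpos hgen,
    exists_isEmbeddedSubmanifold_polygonSpace hd hpos' hgen', fun hS hS' => ?_⟩
  have hchamber' : SameChamber ℓ' ℓ := fun J => (hchamber J).symm
  exact ⟨⟨hchamber.polygonEquiv d hpos hpos' hgen hgen',
    hS.contMDiff_of_contDiffOn hS' (hchamber.contDiffOn_balancedPolygon hpos hpos' hgen')
      fun _ => rfl,
    hS'.contMDiff_of_contDiffOn hS (hchamber'.contDiffOn_balancedPolygon hpos' hpos hgen)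
      fun _ => rfl⟩, hchamber.polygonEquiv_smul hpos hpos' hgen hgen'⟩
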